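/- Rings are associative but not necessarily unital. A ring $R$ *has local units* if every finite subset of $R$ is contained in a corner $eRe$ with $e=e^2\in R$. It is an *exchange ring* if for each $x\in R$ there exist an idempotent $e\in R$ and elements $r,s\in R$ with $e=xr=x+s-xs$. It is *purely infinite* if (i) no quotient of $R$ by a two-sided ideal is a division ring, and (ii) whenever $a\in R$ and $b\in RaR$ (the set of finite sums of products $xay$ with $x,y\in R$), there exist $\alpha,\beta\in R$ with $b=\alpha a\beta$. Let $R\text{-}\mathrm{Mod}$ be the full subcategory of the category of left $R$-modules consisting of the modules $M$ with $RM=M$ such that, for $m\in M$, $Rm=0$ implies $m=0$. Two rings with local units $R$ and $S$ are *Morita equivalent* if the categories $R\text{-}\mathrm{Mod}$ and $S\text{-}\mathrm{Mod}$ are equivalent. **Theorem.** Let $R$ and $S$ be rings with local units that are Morita equivalent. Then $R$ is purely infinite and exchange if and only if $S$ is purely infinite and exchange. -/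

import Mathlib

open CategoryTheory

universe u

namespace NonUnitalMorita

/-! Rings are associative but not assumed to be unital. -/

/-- `R` has local units: each finite subset of `R` is contained in a corner `eRe`, where `e` is an
idempotent of `R`. -/
def HasLocalUnits (R : Type u) [NonUnitalRing R] : Prop :=
  ∀ F : Finset R, ∃ e : R, IsIdempotentElem e ∧ ∀ x ∈ F, ∃ r : R, x = e * r * e

/-- `R` is an exchange ring: for each `x` there are an idempotent `e` and elements `r`, `s` of `R`
with `e = x r = x + s - x s`. -/
def IsExchange (R : Type u) [NonUnitalRing R] : Prop :=
  ∀ x : R, ∃ e r s : R, IsIdempotentElem e ∧ e = x * r ∧ e = x + s - x * s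

/-- The relation `x ≾ y` for elements of `R`, that is, for `1 × 1` matrices over `R`:
`x = α y β` for some `α`, `β` in `R` (not in a unitization of `R`). -/
def Precsim {R : Type u} [NonUnitalRing R] (x y : R) : Prop :=
  ∃ α β : R, x = α * y * β

/-- `RaR`, the set of finite sums of products `x a y` with `x`, `y` in `R`. -/
def mulMul {R : Type u} [NonUnitalRing R] (a : R) : AddSubgroup R :=
  AddSubgroup.closure {z | ∃ x y : R, z = x * a * y}

/-- The (a priori non-unital) ring `D` is a division ring: it has a nonzero identity element, and
every nonzero element has a two-sided inverse. -/
def IsDivRing (D : Type u) [NonUnitalRing D] : Prop :=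
  ∃ e : D, e ≠ 0 ∧ (∀ x : D, e * x = x ∧ x * e = x) ∧
    ∀ x : D, x ≠ 0 → ∃ y : D, x * y = e ∧ y * x = e

/-- `R` is purely infinite: no quotient of `R` by a two-sided ideal is a division ring, and
`b ≾ a` whenever `b ∈ RaR`. -/
def IsPurelyInfinite (R : Type u) [NonUnitalRing R] : Prop :=
  (∀ I : TwoSidedIdeal R, ¬ IsDivRing I.ringCon.Quotient) ∧
    ∀ a b : R, b ∈ mulMul a → Precsim b a

/-- The objects of the category `R`-Mod: left modules `M` over the ring `R` (additive groups with
a ring homomorphism `R → End(M)`, preserving sums and products) such that `M = RM`, i.e. every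
element is a finite sum of elements `r m`, and such that `Rm = 0` implies `m = 0`. -/
structure UnitalMod (R : Type u) [NonUnitalRing R] where
  /-- the underlying type -/
  carrier : Type u
  [addCommGroup : AddCommGroup carrier]
  /-- the action of `R` by additive endomorphisms -/
  act : R →ₙ+* AddMonoid.End carrier
  unital : AddSubgroup.closure {x : carrier | ∃ (r : R) (m : carrier), x = act r m} = ⊤
  nondegenerate : ∀ m : carrier, (∀ r : R, act r m = 0) → m = 0

attribute [instance] UnitalMod.addCommGroup

namespace UnitalMod

/-- The morphisms of `R`-Mod: all homomorphisms of left `R`-modules. -/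
@[ext]
structure Hom {R : Type u} [NonUnitalRing R] (M N : UnitalMod R) where
  /-- the underlying additive map -/
  toAddHom : M.carrier →+ N.carrier
  map_act : ∀ (r : R) (m : M.carrier), toAddHom (M.act r m) = N.act r (toAddHom m)

/-- The category `R`-Mod, with composition of maps. -/
instance category (R : Type u) [NonUnitalRing R] : Category.{u} (UnitalMod R) where
  Hom M N := Hom M N
  id M := ⟨AddMonoidHom.id M.carrier, fun _ _ => rfl⟩
  comp f g := ⟨g.toAddHom.comp f.toAddHom, fun r m => by
    simp only [AddMonoidHom.comp_apply, f.map_act, g.map_act]⟩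
  id_comp _ := rfl
  comp_id _ := rfl
  assoc _ _ _ := rfl

end UnitalMod

/-- Morita equivalence (of idempotent rings, e.g. rings with local units): the categories `R`-Mod
and `S`-Mod of unital nondegenerate left modules are equivalent. -/
def MoritaEquivalent (R S : Type u) [NonUnitalRing R] [NonUnitalRing S] : Prop :=
  Nonempty (UnitalMod R ≌ UnitalMod S)

end NonUnitalMorita

namespace NonUnitalMorita

/-! The property that moves between the two rings is that every corner `eRe` splits: it contains an
idempotent `p` with `p` and `1 - p` both full. Equivalently, `Re ⊕ Re` is a retract of `Re`.
Splitting makes a single `Re` absorb finite direct sums, so matrix rings never enter.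

Corners of `R` inherit exchange and comparison directly. They also have no division ring quotient:
if `eRe/I` were one, dividing `R` by the largest ideal `J` with `eJe ⊆ I` would give a ring with
comparison and a division ring corner, and comparison would force all of `R/J` to be that corner
(`HasComparison.isDivRing`). A unital exchange ring with comparison and without division ring
quotients splits (`IsExchange.splits`): Zorn's lemma gives an ideal maximal among those modulo which
there is no splitting; the quotient by it has a nontrivial idempotent, hence a proper full one,
hence a splitting, and this lifts because idempotents lift in exchange rings.

On the module side, `Sf` is generated by one element, and the images under the equivalence of the
modules `Re` generate every module. So the identity of `Sf` is a finite sum of endomorphisms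
factoring through such images; local units and splitting allow a single `e`. Thus `Sf` is a retract
of the image of `Re`, and `fSf` is isomorphic to a corner of `R` (`exists_corner_ringEquiv`). Local
units finally recover the properties of `S` from its corners. -/

/-- The comparison property: `b ≾ a` whenever `b ∈ RaR`. -/
def HasComparison (R : Type u) [NonUnitalRing R] : Prop :=
  ∀ a b : R, b ∈ mulMul a → Precsim b a

/-- An element `x` of a unital ring such that `1 ≾ x`. -/
def IsFull {A : Type u} [Ring A] (x : A) : Prop := ∃ α β : A, α * x * β = 1

/-- `A / J` contains an idempotent, lifted to an idempotent of `A`, such that it and its complement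
are full. -/
def SplitsModulo {A : Type u} [Ring A] (J : TwoSidedIdeal A) : Prop :=
  ∃ p α β γ δ : A, IsIdempotentElem p ∧ 1 - α * p * β ∈ J ∧ 1 - γ * (1 - p) * δ ∈ J

/-- The unital ring `A` contains an idempotent such that it and its complement are full. -/
def Splits (A : Type u) [Ring A] : Prop :=
  ∃ p : A, IsIdempotentElem p ∧ IsFull p ∧ IsFull (1 - p)

/-! ### Splitting of unital exchange rings with comparison -/

/-- Idempotents of a corner of an exchange ring lift modulo every two-sided ideal. -/
theorem IsExchange.exists_lift_corner {A : Type u} [NonUnitalRing A] (hA : IsExchange A)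
    (J : TwoSidedIdeal A) {f x : A} (hxf : x * f = x) (hfx : f * x = x)
    (hff : IsIdempotentElem f) (hx : x * x - x ∈ J) :
    ∃ p : A, IsIdempotentElem p ∧ f * p = p ∧ p * f = p ∧ x - p ∈ J := by
  obtain ⟨e, r, s, he, her, hes⟩ := hA x
  have hfe : f * e = e := by rw [her, ← mul_assoc, hfx]
  -- As `e ∈ xA ⊆ fA`, only the right side has to be cut by `f`; modulo `J`, both formulas for `e`
  -- give `ef ≡ x(ef) ≡ x`.
  refine ⟨e * f, ?_, ?_, ?_, ?_⟩
  · show e * f * (e * f) = e * f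
    rw [mul_assoc, ← mul_assoc f, hfe, ← mul_assoc, he.eq]
  · rw [← mul_assoc, hfe]
  · rw [mul_assoc, hff.eq]
  · have h1 : x * (e * f) - e * f ∈ J := by
      have : x * (e * f) - e * f = (x * x - x) * (r * f) := by
        rw [her]; simp only [mul_assoc, sub_mul]
      rw [this]; exact J.mul_mem_right _ _ hx
    have h2 : x - x * (e * f) ∈ J := by
      have : x - x * (e * f) = (x * x - x) * (s * f) - (x * x - x) := by
        rw [hes]; simp only [mul_assoc, sub_mul, mul_sub, mul_add, add_mul, hxf]; abel
      rw [this]; exact J.sub_mem (J.mul_mem_right _ _ hx) hx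
    have := J.add_mem h2 h1
    simpa using this

theorem HasComparison.isFull {A : Type u} [Ring A] (hA : HasComparison A) {x : A}
    (h : (1 : A) ∈ TwoSidedIdeal.span {x}) : IsFull x := by
  have : (1 : A) ∈ mulMul x := by
    rw [TwoSidedIdeal.mem_span_iff_mem_addSubgroup_closure] at h
    refine AddSubgroup.closure_mono ?_ h
    rintro z ⟨w, ⟨a, -, b, rfl, rfl⟩, c, -, rfl⟩
    exact ⟨a, c, rfl⟩
  obtain ⟨α, β, h⟩ := hA _ _ this
  exact ⟨α, β, h.symm⟩

theorem mem_span_self {A : Type u} [Ring A] (x : A) : x ∈ TwoSidedIdeal.span {x} :=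
  TwoSidedIdeal.subset_span rfl

theorem mem_of_mem_span {A : Type u} [Ring A] {J : TwoSidedIdeal A} {x y : A} (hx : x ∈ J)
    (hy : y ∈ TwoSidedIdeal.span {x}) : y ∈ J :=
  TwoSidedIdeal.span_le.2 (Set.singleton_subset_iff.2 hx) hy

theorem one_mem_of_mem {A : Type u} [Ring A] {J : TwoSidedIdeal A} {x α β : A} (hx : x ∈ J)
    (h : 1 - α * x * β ∈ J) : (1 : A) ∈ J := by
  have := J.add_mem h (J.mul_mem_right _ β (J.mul_mem_left α _ hx))
  simpa using this

/-- If `xy = 1`, then `yx` is idempotent, and `yx = 0` is possible only when `1 = 0`. -/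
theorem mul_eq_one_comm_of_idempotents_trivial {B : Type u} [Ring B]
    (hB : ∀ e : B, IsIdempotentElem e → e = 0 ∨ e = 1) {x y : B} (h : x * y = 1) : y * x = 1 := by
  rcases hB (y * x) (by
    show y * x * (y * x) = y * x
    rw [mul_assoc, ← mul_assoc x, h, one_mul]) with h0 | h1
  · have h10 : (1 : B) = 0 := by
      calc (1 : B) = x * (y * x) * y := by rw [← mul_assoc, h, one_mul, h]
        _ = 0 := by rw [h0]; simp
    rw [h0, h10]
  · exact h1

/-- If every proper quotient of `B` splits, then either `B` has a nontrivial idempotent or all its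
nonzero elements are invertible. -/
theorem exists_idempotent_ne {B : Type u} [Ring B] (hc : HasComparison B)
    (hdiv : ¬ ∀ x : B, x ≠ 0 → ∃ y, x * y = 1 ∧ y * x = 1)
    (hJ : ∀ x : B, x ≠ 0 → SplitsModulo (TwoSidedIdeal.span {x})) :
    ∃ e : B, IsIdempotentElem e ∧ e ≠ 0 ∧ e ≠ 1 := by
  by_contra! hB
  have hB' : ∀ e : B, IsIdempotentElem e → e = 0 ∨ e = 1 := fun e he => by
    by_cases h : e = 0
    · exact .inl h
    · exact .inr (hB e he h)
  apply hdiv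
  intro x hx
  obtain ⟨p, α, β, γ, δ, hp, h1, h2⟩ := hJ x hx
  -- With `p` equal to `0` or `1`, one of the two fullness conditions says that the quotient by `x`
  -- is zero.
  have hx1 : (1 : B) ∈ TwoSidedIdeal.span {x} := by
    rcases hB' p hp with rfl | rfl
    · simpa using h1
    · simpa using h2
  obtain ⟨a, b, hab⟩ := hc.isFull hx1
  have h3 : x * b * a = 1 :=
    mul_eq_one_comm_of_idempotents_trivial hB' (by rwa [mul_assoc] at hab)
  refine ⟨b * a, by rwa [← mul_assoc], ?_⟩
  exact mul_eq_one_comm_of_idempotents_trivial hB' (by rwa [← mul_assoc])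

/-- Enlarging a nontrivial idempotent to a proper full one. -/
theorem exists_isFull_idempotent_ne_one {B : Type u} [Ring B] (hex : IsExchange B)
    (hc : HasComparison B) {e : B} (he : IsIdempotentElem e) (he1 : e ≠ 1)
    (hJ : SplitsModulo (TwoSidedIdeal.span {e})) :
    ∃ g : B, IsIdempotentElem g ∧ IsFull g ∧ g ≠ 1 := by
  by_cases hfull : (1 : B) ∈ TwoSidedIdeal.span {e}
  · exact ⟨e, he, hc.isFull hfull, he1⟩
  obtain ⟨p, α, β, γ, δ, hp, h1, h2⟩ := hJ
  set J := TwoSidedIdeal.span {e} with hJdef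
  have heJ : e ∈ J := mem_span_self e
  have hf : IsIdempotentElem (1 - e) := he.one_sub
  have key : ∀ y : B, y - (1 - e) * y * (1 - e) ∈ J := fun y => by
    have : y - (1 - e) * y * (1 - e) = e * (y * (1 - e)) + y * e := by noncomm_ring
    rw [this]
    exact J.add_mem (J.mul_mem_right _ _ heJ) (J.mul_mem_left _ _ heJ)
  set f := 1 - e with hfdef
  have hxx : (f * p * f) * (f * p * f) - f * p * f ∈ J := by
    have : (f * p * f) * (f * p * f) - f * p * f = - (f * p * e * p * f) := by
      have hff := hf.eq
      have hpp := hp.eq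
      have e1 : (f * p * f) * (f * p * f) = f * p * f * p * f := by
        simp only [mul_assoc]; rw [← mul_assoc f f, hff]
      have e2 : f * p * f = f * p * p * f := by rw [mul_assoc f p p, hpp]
      rw [e1]; nth_rw 2 [e2]; rw [hfdef]; noncomm_ring
    rw [this]
    exact J.neg_mem (J.mul_mem_right _ _ (J.mul_mem_right _ _ (J.mul_mem_left _ _ heJ)))
  -- Modulo `J`, `f` is `1`, so `fpf ≡ p`. Lifting inside the corner of `f` makes `q` orthogonal to
  -- `e`.
  obtain ⟨q, hq, hfq, hqf, hpq⟩ := hex.exists_lift_corner J (f := f) (x := f * p * f)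
    (by rw [mul_assoc, hf.eq]) (by rw [← mul_assoc, ← mul_assoc, hf.eq]) hf hxx
  have hpq' : p - q ∈ J := by
    have := J.add_mem (key p) hpq
    simpa using this
  have heq : e * q = 0 := by
    have : e * q = q - f * q := by rw [hfdef]; noncomm_ring
    rw [this, hfq, sub_self]
  have hqe : q * e = 0 := by
    have : q * e = q - q * f := by rw [hfdef]; noncomm_ring
    rw [this, hqf, sub_self]
  refine ⟨e + q, ?_, ?_, ?_⟩
  · show (e + q) * (e + q) = e + q
    simp [mul_add, add_mul, heq, hqe, he.eq, hq.eq]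
  · apply hc.isFull
    set K := TwoSidedIdeal.span {e + q}
    have hK : e + q ∈ K := mem_span_self _
    have heK : e ∈ K := by
      have := K.mul_mem_left e _ hK
      rwa [mul_add, heq, he.eq, add_zero] at this
    have hqK : q ∈ K := by
      have := K.sub_mem hK heK
      simpa using this
    have hpK : p ∈ K := by
      have := K.add_mem (mem_of_mem_span heK hpq') hqK
      simpa using this
    exact one_mem_of_mem hpK (mem_of_mem_span heK h1)
  -- If `e + q = 1`, then `1 - p ≡ e ≡ 0` modulo `J`; but `1 - p` is full modulo `J`, so `e` would
  -- be full.
  · intro h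
    apply hfull
    have : 1 - p ∈ J := by
      have h3 : 1 - p = e - (p - q) := by rw [← h]; abel
      rw [h3]; exact J.sub_mem heJ hpq'
    exact one_mem_of_mem this h2

/-- Put `f = 1 - g`. Fullness of `g` gives `uv = 1` with `fv = uf = 0`, so `f`, `vfu`, `v²u²` are
orthogonal idempotents: two copies of `f` and one of `1`. One copy of `f` goes with the `p`-part of
`v²u²`, the other with the `(1 - p)`-part; each side generates `B`, since `p` and `1 - p` are full
modulo `f`. -/
theorem splits_of_isFull_idempotent {B : Type u} [Ring B] (hc : HasComparison B) {g : B}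
    (hg : IsIdempotentElem g) (hfull : IsFull g)
    (hJ : SplitsModulo (TwoSidedIdeal.span {1 - g})) : Splits B := by
  obtain ⟨a, b, hab⟩ := hfull
  obtain ⟨p, α, β, γ, δ, hp, h1, h2⟩ := hJ
  have hf : IsIdempotentElem (1 - g) := hg.one_sub
  have huv : (a * g) * (g * b) = 1 := by
    rw [← hab]; simp only [mul_assoc]; rw [← mul_assoc g g, hg.eq]
  have hfv : (1 - g) * (g * b) = 0 := by rw [← mul_assoc, sub_mul, hg.eq]; simp
  have huf : (a * g) * (1 - g) = 0 := by rw [mul_assoc, mul_sub, hg.eq]; simp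
  generalize a * g = u at *
  generalize g * b = v at *
  generalize 1 - g = f at *
  have huv' : ∀ x, u * (v * x) = x := fun x => by rw [← mul_assoc, huv, one_mul]
  have hfv' : ∀ x, f * (v * x) = 0 := fun x => by rw [← mul_assoc, hfv, zero_mul]
  have huf' : ∀ x, u * (f * x) = 0 := fun x => by rw [← mul_assoc, huf, zero_mul]
  have hff' : ∀ x, f * (f * x) = f * x := fun x => by rw [← mul_assoc, hf.eq]
  have hpp' : ∀ x, p * (p * x) = p * x := fun x => by rw [← mul_assoc, hp.eq]
  set h := f + v * (v * (p * (u * u))) with hh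
  have hidem : IsIdempotentElem h := by
    show h * h = h
    simp only [hh, mul_add, add_mul, mul_assoc, huv', hfv', hpp', hf.eq, huf, mul_zero,
      add_zero, zero_add]
  refine ⟨h, hidem, ?_, ?_⟩
  · apply hc.isFull
    set K := TwoSidedIdeal.span {h}
    have hK : h ∈ K := mem_span_self _
    have hfK : f ∈ K := by
      have := K.mul_mem_left f _ hK
      rwa [hh, mul_add, hfv', hf.eq, add_zero] at this
    have hpK : p ∈ K := by
      have := K.mul_mem_right _ (v * v) (K.mul_mem_left (u * u) _ hK)
      simpa only [hh, mul_add, add_mul, mul_assoc, huv', huv, huf', mul_zero, zero_add,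
        mul_one] using this
    exact one_mem_of_mem hpK (mem_of_mem_span hfK h1)
  · apply hc.isFull
    set K := TwoSidedIdeal.span {1 - h}
    have hK : 1 - h ∈ K := mem_span_self _
    -- This element lies under `1 - h`: multiplying `1 - h` by it on the left returns it.
    have hqK : v * (f * u) + v * (v * ((1 - p) * (u * u))) ∈ K := by
      have := K.mul_mem_left (v * (f * u) + v * (v * ((1 - p) * (u * u)))) _ hK
      convert this using 1
      simp only [hh, mul_add, add_mul, mul_sub, sub_mul, mul_assoc, huv', hfv', huf, hpp',
        mul_zero, mul_one, one_mul]
      abel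
    have hpK : 1 - p ∈ K := by
      have := K.mul_mem_right _ (v * v) (K.mul_mem_left (u * u) _ hqK)
      simpa only [mul_add, add_mul, mul_sub, sub_mul, mul_assoc, huv', huv, huf', mul_zero,
        zero_add, mul_one, one_mul] using this
    have hfK : f ∈ K := by
      have h3 : v * (f * u) ∈ K := by
        have := K.sub_mem hqK
          (K.mul_mem_left v _ (K.mul_mem_left v _ (K.mul_mem_right _ (u * u) hpK)))
        simpa using this
      have := K.mul_mem_right _ v (K.mul_mem_left u _ h3)
      simpa only [mul_assoc, huv', huv, mul_one] using this
    exact one_mem_of_mem hpK (mem_of_mem_span hfK h2)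

theorem splits_of_forall_splitsModulo {B : Type u} [Ring B] (hex : IsExchange B)
    (hc : HasComparison B)
    (hdiv : ¬ ((1 : B) ≠ 0 ∧ ∀ x : B, x ≠ 0 → ∃ y, x * y = 1 ∧ y * x = 1))
    (hJ : ∀ x : B, x ≠ 0 → SplitsModulo (TwoSidedIdeal.span {x})) : Splits B := by
  by_cases h10 : (1 : B) = 0
  · have : Subsingleton B := subsingleton_of_zero_eq_one h10.symm
    exact ⟨0, Subsingleton.elim _ _, ⟨0, 0, Subsingleton.elim _ _⟩, ⟨0, 0, Subsingleton.elim _ _⟩⟩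
  obtain ⟨e, he, he0, he1⟩ := exists_idempotent_ne hc (fun h => hdiv ⟨h10, h⟩) hJ
  obtain ⟨g, hg, hfull, hg1⟩ := exists_isFull_idempotent_ne_one hex hc he he1 (hJ e he0)
  exact splits_of_isFull_idempotent hc hg hfull (hJ _ (sub_ne_zero.2 hg1.symm))

/-! ### Quotients and the maximal ideal without splitting -/

theorem IsExchange.of_surjective {A B : Type u} [NonUnitalRing A] [NonUnitalRing B]
    (hA : IsExchange A) (π : A →ₙ+* B) (hπ : Function.Surjective π) : IsExchange B := by
  intro x
  obtain ⟨x, rfl⟩ := hπ x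
  obtain ⟨e, r, s, he, h1, h2⟩ := hA x
  refine ⟨π e, π r, π s, ?_, ?_, ?_⟩
  · show π e * π e = π e
    rw [← map_mul, he.eq]
  · rw [← map_mul, h1]
  · rw [← map_mul, ← map_add, ← map_sub, ← h2]

theorem HasComparison.of_surjective {A B : Type u} [NonUnitalRing A] [NonUnitalRing B]
    (hA : HasComparison A) (π : A →ₙ+* B) (hπ : Function.Surjective π) : HasComparison B := by
  intro a b hb
  obtain ⟨a, rfl⟩ := hπ a
  have : ∃ b', b' ∈ mulMul a ∧ π b' = b := by
    induction hb using AddSubgroup.closure_induction with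
    | mem z hz =>
      obtain ⟨x, y, rfl⟩ := hz
      obtain ⟨x, rfl⟩ := hπ x
      obtain ⟨y, rfl⟩ := hπ y
      exact ⟨x * a * y, AddSubgroup.subset_closure ⟨x, y, rfl⟩, by simp⟩
    | zero => exact ⟨0, zero_mem _, map_zero _⟩
    | add y z _ _ hy hz =>
      obtain ⟨y, hy, rfl⟩ := hy
      obtain ⟨z, hz, rfl⟩ := hz
      exact ⟨y + z, add_mem hy hz, map_add _ _ _⟩
    | neg y _ hy =>
      obtain ⟨y, hy, rfl⟩ := hy
      exact ⟨-y, neg_mem hy, map_neg _ _⟩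
  obtain ⟨b', hb', rfl⟩ := this
  obtain ⟨α, β, h⟩ := hA a b' hb'
  exact ⟨π α, π β, by rw [h]; simp⟩

/-- The quotient map modulo a two-sided ideal of a non-unital ring. -/
def quotientMap {A : Type u} [NonUnitalRing A] (I : TwoSidedIdeal A) :
    A →ₙ+* I.ringCon.Quotient where
  toFun x := (x : I.ringCon.Quotient)
  map_mul' _ _ := rfl
  map_add' _ _ := rfl
  map_zero' := rfl

theorem quotientMap_surjective {A : Type u} [NonUnitalRing A] (I : TwoSidedIdeal A) :
    Function.Surjective (quotientMap I) := fun x => Quotient.inductionOn' x fun a => ⟨a, rfl⟩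

theorem quotientMap_eq {A : Type u} [NonUnitalRing A] (I : TwoSidedIdeal A) {x y : A} :
    quotientMap I x = quotientMap I y ↔ x - y ∈ I := by
  rw [← TwoSidedIdeal.rel_iff]
  exact RingCon.eq _

theorem quotientMap_eq_zero {A : Type u} [NonUnitalRing A] (I : TwoSidedIdeal A) {x : A} :
    quotientMap I x = 0 ↔ x ∈ I := by
  rw [← map_zero (quotientMap I), quotientMap_eq, sub_zero]

/-- A splitting is witnessed by finitely many elements of `A` and two memberships, so one modulo the
union of a chain already occurs modulo a member. -/
theorem exists_maximal_not_splitsModulo {A : Type u} [Ring A] (hA : ¬ Splits A) :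
    ∃ I : TwoSidedIdeal A, Maximal (fun I => ¬ SplitsModulo I) I := by
  refine (zorn_le_nonempty₀ {I : TwoSidedIdeal A | ¬ SplitsModulo I} ?_ ⊥ ?_).imp fun _ h => h.2
  · intro c hc hchain y hy
    have hdir : ∀ J ∈ c, ∀ K ∈ c, ∃ L ∈ c, J ≤ L ∧ K ≤ L := fun J hJ K hK => by
      rcases hchain.total hJ hK with h | h
      · exact ⟨K, hK, h, le_rfl⟩
      · exact ⟨J, hJ, le_rfl, h⟩
    let U : TwoSidedIdeal A := .mk' {x | ∃ J ∈ c, x ∈ J} ⟨y, hy, y.zero_mem⟩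
      (by
        rintro a b ⟨J, hJ, ha⟩ ⟨K, hK, hb⟩
        obtain ⟨L, hL, h1, h2⟩ := hdir J hJ K hK
        exact ⟨L, hL, L.add_mem (h1 ha) (h2 hb)⟩)
      (by rintro a ⟨J, hJ, ha⟩; exact ⟨J, hJ, J.neg_mem ha⟩)
      (by rintro a b ⟨J, hJ, ha⟩; exact ⟨J, hJ, J.mul_mem_left _ _ ha⟩)
      (by rintro a b ⟨J, hJ, ha⟩; exact ⟨J, hJ, J.mul_mem_right _ _ ha⟩)
    have hU : ∀ x, x ∈ U ↔ ∃ J ∈ c, x ∈ J := fun x => TwoSidedIdeal.mem_mk' ..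
    refine ⟨U, ?_, fun J hJ x hx => (hU x).2 ⟨J, hJ, hx⟩⟩
    rintro ⟨p, α, β, γ, δ, hp, h1, h2⟩
    obtain ⟨J, hJ, h1⟩ := (hU _).1 h1
    obtain ⟨K, hK, h2⟩ := (hU _).1 h2
    obtain ⟨L, hL, hJL, hKL⟩ := hdir J hJ K hK
    exact hc hL ⟨p, α, β, γ, δ, hp, hJL h1, hKL h2⟩
  · rintro ⟨p, α, β, γ, δ, hp, h1, h2⟩
    rw [TwoSidedIdeal.mem_bot, sub_eq_zero] at h1 h2
    exact hA ⟨p, hp, ⟨α, β, h1.symm⟩, ⟨γ, δ, h2.symm⟩⟩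

/-- A unital exchange ring with comparison and without quotient division rings has an idempotent
which is full, together with its complement. -/
theorem IsExchange.splits {A : Type u} [Ring A] (hex : IsExchange A) (hc : HasComparison A)
    (hdiv : ∀ I : TwoSidedIdeal A, (1 : A) ∉ I → ∃ x ∉ I, ∀ y, x * y - 1 ∈ I → y * x - 1 ∉ I) :
    Splits A := by
  by_contra hA
  obtain ⟨I, hI, hmax⟩ := exists_maximal_not_splitsModulo hA
  let π : A →+* I.ringCon.Quotient := I.ringCon.mk'
  have hsurj : Function.Surjective π := quotientMap_surjective I
  have hπ0 : ∀ x, π x = 0 ↔ x ∈ I := fun x => quotientMap_eq_zero I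
  have hπ : ∀ x y, π x = π y ↔ x - y ∈ I := fun x y => quotientMap_eq I
  have hB : Splits I.ringCon.Quotient := by
    apply splits_of_forall_splitsModulo
    · exact hex.of_surjective (π : A →ₙ+* I.ringCon.Quotient) hsurj
    · exact hc.of_surjective (π : A →ₙ+* I.ringCon.Quotient) hsurj
    · rintro ⟨h10, h⟩
      obtain ⟨x, hx, hxy⟩ := hdiv I fun h1 => h10 (by rw [← map_one π, hπ0]; exact h1)
      obtain ⟨y, h1, h2⟩ := h (π x) (by rwa [Ne, hπ0])
      obtain ⟨y, rfl⟩ := hsurj y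
      rw [← map_mul, ← map_one π, hπ] at h1 h2
      exact hxy y h1 h2
    · intro x hx
      obtain ⟨x, rfl⟩ := hsurj x
      rw [Ne, hπ0] at hx
      set K := TwoSidedIdeal.comap π (TwoSidedIdeal.span {π x}) with hK
      have hxK : x ∈ K := (TwoSidedIdeal.mem_comap π).2 (mem_span_self _)
      have hIK : I ≤ K := fun z hz => (TwoSidedIdeal.mem_comap π).2 (by
        rw [(hπ0 z).2 hz]; exact TwoSidedIdeal.zero_mem _)
      -- `K` strictly contains the maximal `I`, because `x ∈ K` and `x ∉ I`.
      have hKs : SplitsModulo K := by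
        by_contra h
        exact hx (hmax h hIK hxK)
      obtain ⟨p, α, β, γ, δ, hp, h1, h2⟩ := hKs
      refine ⟨π p, π α, π β, π γ, π δ, hp.map π, ?_, ?_⟩
      · simpa using (TwoSidedIdeal.mem_comap π).1 h1
      · simpa using (TwoSidedIdeal.mem_comap π).1 h2
  obtain ⟨P, hP, ⟨α, β, h1⟩, γ, δ, h2⟩ := hB
  obtain ⟨x, rfl⟩ := hsurj P
  obtain ⟨α, rfl⟩ := hsurj α
  obtain ⟨β, rfl⟩ := hsurj β
  obtain ⟨γ, rfl⟩ := hsurj γ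
  obtain ⟨δ, rfl⟩ := hsurj δ
  have hxx : x * x - x ∈ I := by rw [← hπ, map_mul, hP.eq]
  obtain ⟨p, hp, -, -, hxp⟩ := hex.exists_lift_corner I (mul_one x) (one_mul x) .one hxx
  rw [(hπ x p).2 hxp] at h1 h2
  refine hI ⟨p, α, β, γ, δ, hp, ?_, ?_⟩
  · rw [← hπ]; simp [h1]
  · rw [← hπ]; simp [h2]

/-! ### Corners -/

/-- The compression `x ↦ exe` to the corner of an idempotent `e`. -/
def compress {R : Type u} [NonUnitalRing R] {e : R} (he : IsIdempotentElem e) (x : R) : he.Corner :=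
  ⟨e * x * e, x, rfl⟩

section Corner

variable {R : Type u} [NonUnitalRing R] {e : R} (he : IsIdempotentElem e)

theorem coe_compress (x : R) : (compress he x).1 = e * x * e := rfl

theorem corner_coe_mul (x y : he.Corner) : (x * y).1 = x.1 * y.1 := rfl

theorem corner_coe_add (x y : he.Corner) : (x + y).1 = x.1 + y.1 := rfl

theorem corner_coe_sub (x y : he.Corner) : (x - y).1 = x.1 - y.1 := rfl

theorem corner_coe_zero : (0 : he.Corner).1 = 0 := rfl

theorem corner_mul_left (x : he.Corner) : e * x.1 = x.1 :=
  ((Subsemigroup.mem_corner_iff he).1 x.2).1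

theorem corner_mul_right (x : he.Corner) : x.1 * e = x.1 :=
  ((Subsemigroup.mem_corner_iff he).1 x.2).2

theorem compress_coe (x : he.Corner) : compress he x.1 = x :=
  Subtype.ext (by rw [coe_compress, corner_mul_left, corner_mul_right])

theorem coe_compress_of_mul {x : R} (h : e * x = x ∧ x * e = x) : (compress he x).1 = x := by
  rw [coe_compress, h.1, h.2]

theorem compress_add (x y : R) : compress he (x + y) = compress he x + compress he y :=
  Subtype.ext (by simp only [corner_coe_add, coe_compress, mul_add, add_mul])

theorem compress_zero : compress he (0 : R) = 0 :=
  Subtype.ext (by simp only [corner_coe_zero, coe_compress, mul_zero, zero_mul])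

theorem compress_neg (x : R) : compress he (-x) = -compress he x :=
  eq_neg_of_add_eq_zero_left (by rw [← compress_add, neg_add_cancel, compress_zero])

theorem compress_mul_left {x : R} (y : R) (h : e * x = x ∧ x * e = x) :
    compress he (x * y) = compress he x * compress he y :=
  Subtype.ext (by
    simp only [corner_coe_mul, coe_compress_of_mul he h, coe_compress]
    rw [← mul_assoc e x, h.1, ← mul_assoc, ← mul_assoc, h.2])

theorem compress_mul_right (x : R) {y : R} (h : e * y = y ∧ y * e = y) :
    compress he (x * y) = compress he x * compress he y :=
  Subtype.ext (by
    simp only [corner_coe_mul, coe_compress_of_mul he h, coe_compress]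
    rw [mul_assoc, mul_assoc, mul_assoc, h.2, mul_assoc, h.1])

theorem IsExchange.corner (hR : IsExchange R) : IsExchange he.Corner := by
  intro x
  obtain ⟨g, r, s, hg, h1, h2⟩ := hR x.1
  have hx : e * x.1 = x.1 ∧ x.1 * e = x.1 := ⟨corner_mul_left he x, corner_mul_right he x⟩
  have heg : e * g = g := by rw [h1, ← mul_assoc, hx.1]
  have hc : (compress he g).1 = g * e := by rw [coe_compress, heg]
  refine ⟨compress he g, compress he r, compress he s, ?_, ?_, ?_⟩
  · refine Subtype.ext ?_
    rw [corner_coe_mul, hc, mul_assoc, ← mul_assoc e, heg, ← mul_assoc, hg.eq]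
  · rw [h1, compress_mul_left he r hx, compress_coe]
  · rw [h2, sub_eq_add_neg, compress_add, compress_add, compress_neg, compress_mul_left he s hx,
      compress_coe, sub_eq_add_neg]

/-- Coefficients found in `R` may be compressed to the corner, because `a = eae` and `b = ebe`. -/
theorem HasComparison.corner (hR : HasComparison R) : HasComparison he.Corner := by
  intro a b hb
  have : b.1 ∈ mulMul a.1 := by
    induction hb using AddSubgroup.closure_induction with
    | mem z hz =>
      obtain ⟨x, y, rfl⟩ := hz
      exact AddSubgroup.subset_closure ⟨x.1, y.1, rfl⟩
    | zero => exact zero_mem _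
    | add y z _ _ hy hz => exact add_mem hy hz
    | neg y _ hy => exact neg_mem hy
  obtain ⟨α, β, h⟩ := hR a.1 b.1 this
  have ha : e * a.1 = a.1 ∧ a.1 * e = a.1 := ⟨corner_mul_left he a, corner_mul_right he a⟩
  refine ⟨compress he α, compress he β, ?_⟩
  rw [← compress_coe he b, h]
  refine Subtype.ext ?_
  simp only [corner_coe_mul, coe_compress, mul_assoc]
  rw [← mul_assoc e a.1, ha.1, ← mul_assoc a.1 e, ha.2]

end Corner

/-! ### Division ring quotients of corners -/

/-- A ring with comparison in which every nonzero ideal meets a corner which is a division ring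
is itself a division ring. -/
theorem HasComparison.isDivRing {Q : Type u} [NonUnitalRing Q] (hc : HasComparison Q) {e : Q}
    (he : IsIdempotentElem e) (he0 : e ≠ 0)
    (hinv : ∀ x : Q, e * x * e ≠ 0 →
      ∃ y, e * y = y ∧ y * e = y ∧ e * x * e * y = e ∧ y * (e * x * e) = e)
    (hprime : ∀ z : Q, z ≠ 0 → ∃ r r' : Q, e * r * z * r' * e ≠ 0) : IsDivRing Q := by
  have hee := he.eq
  have hright : ∀ y : Q, y * e = y := by
    intro y
    by_contra hy
    obtain ⟨r, r', h⟩ := hprime (y - y * e) (sub_ne_zero.2 (Ne.symm hy))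
    obtain ⟨w, hew, hwe, hw, -⟩ := hinv (r * (y - y * e) * r') (by simpa only [mul_assoc] using h)
    obtain ⟨u, v, hue, heu, huv, hve⟩ :
        ∃ u v, u * e = 0 ∧ e * u = u ∧ u * v = e ∧ v * e = v := by
      refine ⟨e * r * (y - y * e), r' * e * w, ?_, ?_, ?_, ?_⟩
      · rw [mul_assoc, sub_mul, mul_assoc y, hee, sub_self, mul_zero]
      · rw [← mul_assoc, ← mul_assoc, hee]
      · simpa only [mul_assoc] using hw
      · rw [mul_assoc, hwe]
    -- Since `ue = 0`, removing `ev` from `v` keeps `uv = e`; now `vu` is an idempotent equivalent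
    -- and orthogonal to `e`.
    obtain ⟨v, huv, hve, hev⟩ : ∃ v, u * v = e ∧ v * e = v ∧ e * v = 0 := by
      refine ⟨v - e * v, ?_, ?_, ?_⟩
      · rw [mul_sub, huv, ← mul_assoc, hue, zero_mul, sub_zero]
      · rw [sub_mul, mul_assoc, hve]
      · rw [mul_sub, ← mul_assoc, hee, sub_self]
    -- Comparison factors the "rank two" idempotent `e + vu` through the "rank one" `e`. As `eαe` is
    -- invertible in the corner, this forces `eβv = 0`, hence `v = 0`.
    obtain ⟨α, β, hαβ⟩ := hc e (e + v * u) (add_mem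
      (AddSubgroup.subset_closure ⟨e, e, by rw [hee, hee]⟩)
      (AddSubgroup.subset_closure ⟨v, u, by rw [hve]⟩))
    have h1 : e * α * e * (β * e) = e := by
      calc e * α * e * (β * e) = e * (α * e * β) * e := by simp only [mul_assoc]
        _ = e := by rw [← hαβ, mul_add, ← mul_assoc, hev, hee, zero_mul, add_zero, hee]
    obtain ⟨c, -, -, -, hc'⟩ := hinv α (by
      intro h0; rw [h0, zero_mul] at h1; exact he0 h1.symm)
    have h2 : e * α * e * (β * v) = 0 := by
      calc e * α * e * (β * v) = e * (α * e * β) * v := by simp only [mul_assoc]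
        _ = 0 := by
          rw [← hαβ, mul_add, ← mul_assoc e v, hev, hee, zero_mul, add_zero, hev]
    have h3 : e * (β * v) = 0 := by
      rw [← hc', mul_assoc, h2, mul_zero]
    have h4 : v = 0 := by
      calc v = (e + v * u) * v := by rw [add_mul, hev, mul_assoc, huv, hve, zero_add]
        _ = 0 := by rw [hαβ, mul_assoc, mul_assoc, h3, mul_zero]
    rw [h4, mul_zero] at huv
    exact he0 huv.symm
  have hleft : ∀ y : Q, e * y = y := by
    intro y
    by_contra hy
    obtain ⟨r, r', h⟩ := hprime (y - e * y) (sub_ne_zero.2 (Ne.symm hy))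
    apply h
    rw [mul_sub, ← mul_assoc (e * r) e y, hright (e * r), sub_self, zero_mul, zero_mul]
  refine ⟨e, he0, fun x => ⟨hleft x, hright x⟩, fun x hx => ?_⟩
  obtain ⟨y, -, -, h1, h2⟩ := hinv x (by rwa [hleft, hright])
  rw [hleft, hright] at h1 h2
  exact ⟨y, h1, h2⟩

/-- Corners of a purely infinite ring have no quotient division rings. -/
theorem IsPurelyInfinite.corner_exists_not_invertible {R : Type u} [NonUnitalRing R]
    (hR : IsPurelyInfinite R) {e : R} (he : IsIdempotentElem e) (I : TwoSidedIdeal he.Corner)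
    (h1 : (1 : he.Corner) ∉ I) : ∃ x ∉ I, ∀ y, x * y - 1 ∈ I → y * x - 1 ∉ I := by
  by_contra! hI
  have hmul : ∀ x r r' : R, compress he x ∈ I → compress he (r * (e * x * e) * r') ∈ I := by
    intro x r r' hx
    have : compress he (r * (e * x * e) * r') = compress he r * compress he x * compress he r' := by
      refine Subtype.ext ?_
      simp only [corner_coe_mul, coe_compress, mul_assoc]
      rw [← mul_assoc e e, he.eq, ← mul_assoc e e, he.eq]
    rw [this]
    exact I.mul_mem_right _ _ (I.mul_mem_left _ _ hx)
  -- The largest ideal with `eJe ⊆ I`. It meets the corner exactly in `I`, and `z ∉ J` means that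
  -- some `erzr'e` is outside `I`, which is the primeness condition.
  let J : TwoSidedIdeal R := .mk' {x | ∀ r r', compress he (r * x * r') ∈ I}
    (by intro r r'; rw [mul_zero, zero_mul, compress_zero]; exact I.zero_mem)
    (by
      intro a b ha hb r r'
      rw [mul_add, add_mul, compress_add]; exact I.add_mem (ha r r') (hb r r'))
    (by intro a ha r r'; rw [mul_neg, neg_mul, compress_neg]; exact I.neg_mem (ha r r'))
    (by intro a b hb r r'; rw [← mul_assoc]; exact hb _ _)
    (by intro a b ha r r'; rw [← mul_assoc, mul_assoc _ b]; exact ha _ _)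
  have hJ : ∀ x, x ∈ J ↔ ∀ r r', compress he (r * x * r') ∈ I := fun x => TwoSidedIdeal.mem_mk' ..
  have hJe : ∀ x, e * x * e ∈ J ↔ compress he x ∈ I := by
    intro x
    refine ⟨fun h => ?_, fun h => (hJ _).2 fun r r' => hmul x r r' h⟩
    have := (hJ _).1 h e e
    convert this using 1
    refine Subtype.ext ?_
    simp only [coe_compress, mul_assoc, he.eq]
    simp only [← mul_assoc, he.eq]
  have hcoe : ∀ x : he.Corner, x.1 ∈ J ↔ x ∈ I := fun x => by
    have := hJe x.1
    rwa [corner_mul_left, corner_mul_right, compress_coe] at this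
  let π := quotientMap J
  have hπ0 : ∀ x, π x = 0 ↔ x ∈ J := fun x => quotientMap_eq_zero J
  have hsurj : Function.Surjective π := quotientMap_surjective J
  apply hR.1 J
  refine HasComparison.isDivRing (e := π e)
    (HasComparison.of_surjective (A := R) hR.2 π hsurj) ?_ ?_ ?_ ?_
  · show π e * π e = π e
    rw [← map_mul, he.eq]
  · rw [Ne, hπ0]
    exact fun h => h1 ((hcoe 1).1 h)
  · intro x hx
    obtain ⟨x, rfl⟩ := hsurj x
    rw [← map_mul, ← map_mul, Ne, hπ0, hJe] at hx
    obtain ⟨y, hy1, hy2⟩ := hI _ hx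
    refine ⟨π y.1, ?_, ?_, ?_, ?_⟩
    · rw [← map_mul, corner_mul_left]
    · rw [← map_mul, corner_mul_right]
    · rw [← map_mul, ← map_mul, ← map_mul, quotientMap_eq]
      exact (hcoe _).2 hy1
    · rw [← map_mul, ← map_mul, ← map_mul, quotientMap_eq]
      exact (hcoe _).2 hy2
  · intro z hz
    obtain ⟨z, rfl⟩ := hsurj z
    rw [Ne, hπ0, hJ] at hz
    push Not at hz
    obtain ⟨r, r', h⟩ := hz
    refine ⟨π r, π r', ?_⟩
    rw [← map_mul, ← map_mul, ← map_mul, ← map_mul, Ne, hπ0]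
    rw [← hJe] at h
    simpa only [mul_assoc] using h

theorem IsPurelyInfinite.corner_splits {R : Type u} [NonUnitalRing R]
    (hR : IsPurelyInfinite R) (hex : IsExchange R) {e : R} (he : IsIdempotentElem e) :
    Splits he.Corner :=
  (hex.corner he).splits (HasComparison.corner he hR.2) (hR.corner_exists_not_invertible he)

/-! ### From corners back to a ring with local units -/

theorem HasLocalUnits.exists_unit {R : Type u} [NonUnitalRing R] (hR : HasLocalUnits R)
    (F : Finset R) : ∃ e : R, IsIdempotentElem e ∧ ∀ x ∈ F, e * x = x ∧ x * e = x := by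
  obtain ⟨e, he, h⟩ := hR F
  refine ⟨e, he, fun x hx => ?_⟩
  obtain ⟨r, hr⟩ := h x hx
  exact (Subsemigroup.mem_corner_iff he).1 ⟨r, hr.symm⟩

theorem HasLocalUnits.isExchange {R : Type u} [NonUnitalRing R] (hR : HasLocalUnits R)
    (h : ∀ (e : R) (he : IsIdempotentElem e), IsExchange he.Corner) : IsExchange R := by
  intro x
  obtain ⟨e, he, hx⟩ := hR.exists_unit {x}
  have hx := hx x (by simp)
  obtain ⟨g, r, s, hg, h1, h2⟩ := h e he (compress he x)
  refine ⟨g.1, r.1, s.1, congrArg Subtype.val hg, ?_, ?_⟩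
  · simpa only [corner_coe_mul, coe_compress_of_mul he hx] using congrArg Subtype.val h1
  · simpa only [corner_coe_mul, corner_coe_add, corner_coe_sub, coe_compress_of_mul he hx]
      using congrArg Subtype.val h2

/-- Membership `b ∈ RaR` involves finitely many coefficients, so it already holds in any corner
whose unit fixes them together with `a`. -/
theorem HasLocalUnits.hasComparison {R : Type u} [NonUnitalRing R] (hR : HasLocalUnits R)
    (h : ∀ (e : R) (he : IsIdempotentElem e), HasComparison he.Corner) : HasComparison R := by
  classical
  intro a b hb
  have : ∃ F : Finset R, ∀ (e : R) (he : IsIdempotentElem e), (e * a = a ∧ a * e = a) →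
      (∀ x ∈ F, e * x = x ∧ x * e = x) → compress he b ∈ mulMul (compress he a) := by
    induction hb using AddSubgroup.closure_induction with
    | mem z hz =>
      obtain ⟨x, y, rfl⟩ := hz
      refine ⟨{x, y}, fun e he ha hF => ?_⟩
      rw [compress_mul_right he _ (hF y (by simp)), compress_mul_left he _ (hF x (by simp))]
      exact AddSubgroup.subset_closure ⟨_, _, rfl⟩
    | zero => exact ⟨∅, fun e he _ _ => by rw [compress_zero]; exact zero_mem _⟩
    | add y z _ _ hy hz =>
      obtain ⟨F, hF⟩ := hy
      obtain ⟨G, hG⟩ := hz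
      refine ⟨F ∪ G, fun e he ha h => ?_⟩
      rw [compress_add]
      exact add_mem (hF e he ha fun x hx => h x (Finset.mem_union_left _ hx))
        (hG e he ha fun x hx => h x (Finset.mem_union_right _ hx))
    | neg y _ hy =>
      obtain ⟨F, hF⟩ := hy
      refine ⟨F, fun e he ha h => ?_⟩
      rw [compress_neg]
      exact neg_mem (hF e he ha h)
  obtain ⟨F, hF⟩ := this
  obtain ⟨e, he, hu⟩ := hR.exists_unit (insert a (insert b F))
  have ha := hu a (by simp)
  have hb := hu b (by simp)
  obtain ⟨α, β, hαβ⟩ := h e he _ _ (hF e he ha fun x hx => hu x (by simp [hx]))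
  refine ⟨α.1, β.1, ?_⟩
  simpa only [corner_coe_mul, coe_compress_of_mul he ha, coe_compress_of_mul he hb]
    using congrArg Subtype.val hαβ

theorem HasLocalUnits.not_isDivRing {R : Type u} [NonUnitalRing R] (hR : HasLocalUnits R)
    (h : ∀ (e : R) (he : IsIdempotentElem e), Splits he.Corner) (I : TwoSidedIdeal R) :
    ¬ IsDivRing I.ringCon.Quotient := by
  rintro ⟨E, hE0, hE, hinv⟩
  let π := quotientMap I
  obtain ⟨x, hx⟩ := quotientMap_surjective I E
  obtain ⟨e, he, hu⟩ := hR.exists_unit {x}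
  have hπe : π e = E := by
    rw [← (hE (π e)).2, ← hx, ← map_mul, (hu x (by simp)).1]
  obtain ⟨p, hp, ⟨α, β, h1⟩, γ, δ, h2⟩ := h e he
  have h1 : α.1 * p.1 * β.1 = e := congrArg Subtype.val h1
  have h2 : γ.1 * (e - p.1) * δ.1 = e := congrArg Subtype.val h2
  have hp : p.1 * p.1 = p.1 := congrArg Subtype.val hp
  -- An idempotent of a division ring is `0` or `1`; either value contradicts fullness of `p` or of
  -- its complement.
  by_cases hp0 : π p.1 = 0
  · apply hE0
    rw [← hπe, ← h1, map_mul, map_mul, hp0, mul_zero, zero_mul]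
  · obtain ⟨y, hy, -⟩ := hinv _ hp0
    have hpE : π p.1 = E := by
      rw [← (hE (π p.1)).2, ← hy, ← mul_assoc, ← map_mul, hp]
    apply hE0
    rw [← hπe, ← h2, map_mul, map_mul, map_sub, hπe, hpE, sub_self, mul_zero, zero_mul]

/-! ### Additive structure on the module category -/

namespace UnitalMod

section Preadditive

variable {R : Type u} [NonUnitalRing R]

theorem hom_ext {M N : UnitalMod R} {f g : M ⟶ N} (h : ∀ m, f.toAddHom m = g.toAddHom m) : f = g :=
  Hom.ext (AddMonoidHom.ext h)

instance (M N : UnitalMod R) : Zero (M ⟶ N) := ⟨⟨0, fun r m => by simp⟩⟩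

instance (M N : UnitalMod R) : Add (M ⟶ N) :=
  ⟨fun f g => ⟨f.toAddHom + g.toAddHom, fun r m => by simp [f.map_act, g.map_act]⟩⟩

instance (M N : UnitalMod R) : Neg (M ⟶ N) :=
  ⟨fun f => ⟨-f.toAddHom, fun r m => by simp [f.map_act]⟩⟩

instance (M N : UnitalMod R) : AddCommGroup (M ⟶ N) where
  add_assoc f g h := hom_ext fun m => add_assoc _ _ _
  zero_add f := hom_ext fun m => zero_add _
  add_zero f := hom_ext fun m => add_zero _
  add_comm f g := hom_ext fun m => add_comm _ _
  neg_add_cancel f := hom_ext fun m => neg_add_cancel _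
  nsmul := nsmulRec
  zsmul := zsmulRec

instance : Preadditive (UnitalMod R) where
  add_comp _ _ _ f g h := hom_ext fun m => map_add h.toAddHom _ _
  comp_add _ _ _ f g h := hom_ext fun m => rfl

theorem zero_apply {M N : UnitalMod R} (m : M.carrier) : (0 : M ⟶ N).toAddHom m = 0 := rfl

theorem comp_apply {M N P : UnitalMod R} (f : M ⟶ N) (g : N ⟶ P) (m : M.carrier) :
    (f ≫ g).toAddHom m = g.toAddHom (f.toAddHom m) := rfl

theorem act_mul (M : UnitalMod R) (r s : R) (m : M.carrier) :
    M.act (r * s) m = M.act r (M.act s m) := by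
  rw [map_mul]; rfl

theorem act_add (M : UnitalMod R) (r s : R) (m : M.carrier) :
    M.act (r + s) m = M.act r m + M.act s m := by
  rw [map_add]; rfl

/-- The direct sum of two modules. -/
def prod (M N : UnitalMod R) : UnitalMod R where
  carrier := M.carrier × N.carrier
  act :=
    { toFun := fun r => AddMonoidHom.prodMap (M.act r) (N.act r)
      map_mul' := fun r s => by
        refine AddMonoidHom.ext fun m => Prod.ext ?_ ?_
        · exact M.act_mul r s m.1
        · exact N.act_mul r s m.2
      map_zero' := by
        refine AddMonoidHom.ext fun m => Prod.ext ?_ ?_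
        · show M.act 0 m.1 = 0
          rw [map_zero]; rfl
        · show N.act 0 m.2 = 0
          rw [map_zero]; rfl
      map_add' := fun r s => by
        refine AddMonoidHom.ext fun m => Prod.ext ?_ ?_
        · exact M.act_add r s m.1
        · exact N.act_add r s m.2 }
  unital := by
    rw [eq_top_iff]
    rintro ⟨m, n⟩ -
    set K := AddSubgroup.closure {x : M.carrier × N.carrier | ∃ (r : R) (m : M.carrier × N.carrier),
      x = (M.act r m.1, N.act r m.2)}
    have hm : ∀ m, m ∈ AddSubgroup.closure {x | ∃ (r : R) (m : M.carrier), x = M.act r m} →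
        (m, (0 : N.carrier)) ∈ K := by
      intro m hm
      induction hm using AddSubgroup.closure_induction with
      | mem x hx =>
        obtain ⟨r, m, rfl⟩ := hx
        exact AddSubgroup.subset_closure ⟨r, (m, 0), by simp⟩
      | zero => exact zero_mem _
      | add x y _ _ hx hy => simpa using add_mem hx hy
      | neg x _ hx => simpa using neg_mem hx
    have hn : ∀ n, n ∈ AddSubgroup.closure {x | ∃ (r : R) (m : N.carrier), x = N.act r m} →
        ((0 : M.carrier), n) ∈ K := by
      intro n hn
      induction hn using AddSubgroup.closure_induction with
      | mem x hx =>
        obtain ⟨r, n, rfl⟩ := hx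
        exact AddSubgroup.subset_closure ⟨r, (0, n), by simp⟩
      | zero => exact zero_mem _
      | add x y _ _ hx hy => simpa using add_mem hx hy
      | neg x _ hx => simpa using neg_mem hx
    have := add_mem (hm m (by rw [M.unital]; trivial)) (hn n (by rw [N.unital]; trivial))
    have hmn : (m, n) ∈ K := by simpa using this
    exact hmn
  nondegenerate := fun m h => Prod.ext
    (M.nondegenerate _ fun r => congrArg Prod.fst (h r))
    (N.nondegenerate _ fun r => congrArg Prod.snd (h r))

/-- The direct sum, as a bicone. -/
def prodBicone (M N : UnitalMod R) : Limits.BinaryBicone M N where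
  pt := prod M N
  fst := ⟨AddMonoidHom.fst _ _, fun _ _ => rfl⟩
  snd := ⟨AddMonoidHom.snd _ _, fun _ _ => rfl⟩
  inl := ⟨AddMonoidHom.inl _ _, fun r _ => Prod.ext rfl (map_zero (N.act r)).symm⟩
  inr := ⟨AddMonoidHom.inr _ _, fun r _ => Prod.ext (map_zero (M.act r)).symm rfl⟩
  inl_fst := rfl
  inl_snd := rfl
  inr_fst := rfl
  inr_snd := rfl

instance : Limits.HasBinaryBiproducts (UnitalMod R) where
  has_binary_biproduct M N := Limits.hasBinaryBiproduct_of_total (prodBicone M N)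
    (hom_ext fun m => by
      exact Prod.ext (add_zero m.1) (zero_add m.2))

/-- An equivalence preserves binary products, and these determine the addition of morphisms. -/
theorem additive_of_isEquivalence {S : Type u} [NonUnitalRing S]
    (F : UnitalMod R ⥤ UnitalMod S) [F.IsEquivalence] : F.Additive :=
  Functor.additive_of_preserves_binary_products F

end Preadditive

/-! ### The modules `Re`, their endomorphisms, and quotient modules -/

section LocalUnits

variable {R : Type u} [NonUnitalRing R]

/-- Stated for a bare action, so that it can be used to prove nondegeneracy when a module is being
built. -/
theorem exists_idempotent_act_eq_of_closure (hR : HasLocalUnits R) {M : Type u} [AddCommGroup M]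
    (act : R →ₙ+* AddMonoid.End M)
    (hM : AddSubgroup.closure {x : M | ∃ (r : R) (m : M), x = act r m} = ⊤) (m : M) :
    ∃ e : R, IsIdempotentElem e ∧ act e m = m := by
  classical
  have hm : m ∈ AddSubgroup.closure {x | ∃ (r : R) (m : M), x = act r m} := by
    rw [hM]; trivial
  have : ∃ F : Finset R, ∀ e : R, (∀ x ∈ F, e * x = x ∧ x * e = x) → act e m = m := by
    induction hm using AddSubgroup.closure_induction with
    | mem x hx =>
      obtain ⟨r, m, rfl⟩ := hx
      refine ⟨{r}, fun e he => ?_⟩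
      have : act (e * r) m = act e (act r m) := by rw [map_mul]; rfl
      rw [← this, (he r (by simp)).1]
    | zero => exact ⟨∅, fun e _ => map_zero _⟩
    | add x y _ _ hx hy =>
      obtain ⟨F, hF⟩ := hx
      obtain ⟨G, hG⟩ := hy
      exact ⟨F ∪ G, fun e he => by
        rw [map_add, hF e fun x hx => he x (Finset.mem_union_left _ hx),
          hG e fun x hx => he x (Finset.mem_union_right _ hx)]⟩
    | neg x _ hx =>
      obtain ⟨F, hF⟩ := hx
      exact ⟨F, fun e he => by rw [map_neg, hF e he]⟩
  obtain ⟨F, hF⟩ := this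
  obtain ⟨e, he, h⟩ := hR.exists_unit F
  exact ⟨e, he, hF e h⟩

theorem exists_idempotent_act_eq (hR : HasLocalUnits R) (M : UnitalMod R) (m : M.carrier) :
    ∃ e : R, IsIdempotentElem e ∧ M.act e m = m :=
  exists_idempotent_act_eq_of_closure hR M.act M.unital m

theorem eq_zero_of_act_eq_zero (hR : HasLocalUnits R)
    {M : Type u} [AddCommGroup M] (act : R →ₙ+* AddMonoid.End M)
    (hM : AddSubgroup.closure {x : M | ∃ (r : R) (m : M), x = act r m} = ⊤) (m : M)
    (hm : ∀ r, act r m = 0) : m = 0 := by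
  obtain ⟨e, -, he⟩ := exists_idempotent_act_eq_of_closure hR act hM m
  rw [← he, hm e]

/-- The additive group `Re` of all `x` with `xe = x`. -/
def leftIdealGroup (e : R) : AddSubgroup R where
  carrier := {x | x * e = x}
  zero_mem' := zero_mul e
  add_mem' := fun {x y} hx hy => by
    show (x + y) * e = x + y
    rw [add_mul, hx, hy]
  neg_mem' := fun {x} hx => by
    show -x * e = -x
    rw [neg_mul, hx]

/-- The left ideal `Re`, as a module. -/
def leftIdeal (hR : HasLocalUnits R) (e : R) : UnitalMod R :=
  let act : R →ₙ+* AddMonoid.End (leftIdealGroup e) :=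
    { toFun := fun r =>
        { toFun := fun x => ⟨r * x.1, by
            show r * x.1 * e = r * x.1
            rw [mul_assoc, x.2]⟩
          map_zero' := Subtype.ext (mul_zero r)
          map_add' := fun x y => Subtype.ext (mul_add r x.1 y.1) }
      map_mul' := fun r s => AddMonoidHom.ext fun x => Subtype.ext (mul_assoc r s x.1)
      map_zero' := AddMonoidHom.ext fun x => Subtype.ext (zero_mul x.1)
      map_add' := fun r s => AddMonoidHom.ext fun x => Subtype.ext (add_mul r s x.1) }
  have h : AddSubgroup.closure {x : leftIdealGroup e | ∃ r m, x = act r m} = ⊤ := by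
    rw [eq_top_iff]
    rintro x -
    obtain ⟨f, -, hf⟩ := hR.exists_unit {x.1}
    exact AddSubgroup.subset_closure ⟨f, x, Subtype.ext (hf x.1 (by simp)).1.symm⟩
  { carrier := leftIdealGroup e
    act := act
    unital := h
    nondegenerate := eq_zero_of_act_eq_zero hR act h }

/-- The quotient of a module by a submodule. -/
def quotient (hR : HasLocalUnits R) (M : UnitalMod R) (N : AddSubgroup M.carrier)
    (hN : ∀ (r : R), ∀ m ∈ N, M.act r m ∈ N) : UnitalMod R :=
  let act : R →ₙ+* AddMonoid.End (M.carrier ⧸ N) :=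
    { toFun := fun r => QuotientAddGroup.map N N (M.act r) (hN r)
      map_mul' := fun r s => by
        refine QuotientAddGroup.addMonoidHom_ext _ (AddMonoidHom.ext fun m => ?_)
        exact congrArg (QuotientAddGroup.mk (s := N)) (M.act_mul r s m)
      map_zero' := by
        refine QuotientAddGroup.addMonoidHom_ext _ (AddMonoidHom.ext fun m => ?_)
        exact congrArg (QuotientAddGroup.mk (s := N)) (DFunLike.congr_fun (map_zero M.act) m)
      map_add' := fun r s => by
        refine QuotientAddGroup.addMonoidHom_ext _ (AddMonoidHom.ext fun m => ?_)
        exact congrArg (QuotientAddGroup.mk (s := N)) (M.act_add r s m) }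
  have h : AddSubgroup.closure {x : M.carrier ⧸ N | ∃ r m, x = act r m} = ⊤ := by
    rw [eq_top_iff]
    rintro x -
    obtain ⟨m, rfl⟩ := QuotientAddGroup.mk_surjective x
    obtain ⟨f, -, hf⟩ := exists_idempotent_act_eq hR M m
    exact AddSubgroup.subset_closure ⟨f, m, congrArg (QuotientAddGroup.mk (s := N)) hf.symm⟩
  { carrier := M.carrier ⧸ N
    act := act
    unital := h
    nondegenerate := eq_zero_of_act_eq_zero hR act h }

/-- The projection of a module onto its quotient by a submodule. -/
def quotientMk (hR : HasLocalUnits R) (M : UnitalMod R) (N : AddSubgroup M.carrier)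
    (hN : ∀ (r : R), ∀ m ∈ N, M.act r m ∈ N) : M ⟶ quotient hR M N hN :=
  ⟨QuotientAddGroup.mk' N, fun _ _ => rfl⟩

theorem quotientMk_apply_eq_zero (hR : HasLocalUnits R) (M : UnitalMod R) (N : AddSubgroup M.carrier)
    (hN : ∀ (r : R), ∀ m ∈ N, M.act r m ∈ N) (m : M.carrier) :
    (quotientMk hR M N hN).toAddHom m = 0 ↔ m ∈ N :=
  QuotientAddGroup.eq_zero_iff m

/-- The homomorphism `x ↦ xm` from `Re` to `M`. -/
def ofElem (hR : HasLocalUnits R)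
    (e : R) {M : UnitalMod R} (m : M.carrier) : leftIdeal hR e ⟶ M where
  toAddHom :=
    { toFun := fun x => M.act x.1 m
      map_zero' := DFunLike.congr_fun (map_zero M.act) m
      map_add' := fun x y => M.act_add x.1 y.1 m }
  map_act := fun r x => M.act_mul r x.1 m

theorem ofElem_apply (hR : HasLocalUnits R)
    (e : R) {M : UnitalMod R} (m : M.carrier) (x : (leftIdeal hR e).carrier) :
    (ofElem hR e m).toAddHom x = M.act x.1 m := rfl

/-- The generator `e` of `Re`. -/
def gen (hR : HasLocalUnits R)
    {e : R} (he : IsIdempotentElem e) : (leftIdeal hR e).carrier := ⟨e, he.eq⟩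

theorem act_gen (hR : HasLocalUnits R)
    {e : R} (he : IsIdempotentElem e) (x : (leftIdeal hR e).carrier) :
    (leftIdeal hR e).act x.1 (gen hR he) = x := Subtype.ext x.2

theorem leftIdeal_hom_ext (hR : HasLocalUnits R) {e : R} (he : IsIdempotentElem e) {M : UnitalMod R}
    {f g : leftIdeal hR e ⟶ M} (h : f.toAddHom (gen hR he) = g.toAddHom (gen hR he)) : f = g :=
  hom_ext fun x => by rw [← act_gen hR he x, f.map_act, g.map_act, h]

/-- The endomorphisms of `Re` are the right multiplications by elements of `eRe`. -/
def endEquiv (hR : HasLocalUnits R) {e : R} (he : IsIdempotentElem e) :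
    (leftIdeal hR e ⟶ leftIdeal hR e) ≃+ he.Corner where
  toFun f := ⟨(f.toAddHom (gen hR he)).1, (Subsemigroup.mem_corner_iff he).2 ⟨by
    have h := f.map_act e (gen hR he)
    rw [show (leftIdeal hR e).act e (gen hR he) = gen hR he from Subtype.ext he.eq] at h
    exact (congrArg Subtype.val h).symm, (f.toAddHom (gen hR he)).2⟩⟩
  invFun x := ofElem hR e (M := leftIdeal hR e) ⟨x.1, corner_mul_right he x⟩
  left_inv f := leftIdeal_hom_ext hR he (by
    have h := f.map_act e (gen hR he)
    rw [show (leftIdeal hR e).act e (gen hR he) = gen hR he from Subtype.ext he.eq] at h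
    exact h.symm)
  right_inv x := Subtype.ext (corner_mul_left he x)
  map_add' f g := rfl

/-- Endomorphisms act by right multiplication and `≫` composes from left to right, so no opposite
ring appears. -/
theorem endEquiv_comp (hR : HasLocalUnits R)
    {e : R} (he : IsIdempotentElem e) (f g : leftIdeal hR e ⟶ leftIdeal hR e) :
    endEquiv hR he (f ≫ g) = endEquiv hR he f * endEquiv hR he g := by
  refine Subtype.ext ?_
  show (g.toAddHom (f.toAddHom (gen hR he))).1 = _
  rw [← act_gen hR he (f.toAddHom (gen hR he)), g.map_act]
  rfl

theorem endEquiv_id (hR : HasLocalUnits R) {e : R} (he : IsIdempotentElem e) :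
    endEquiv hR he (𝟙 (leftIdeal hR e)) = 1 := rfl

end LocalUnits

end UnitalMod

/-! ### Transport of corners along an equivalence -/

theorem Splits.exists_mul_eq {A : Type u} [Ring A] (hA : Splits A) :
    ∃ x₁ y₁ x₂ y₂ : A, x₁ * y₁ = 1 ∧ x₂ * y₂ = 1 ∧ x₁ * y₂ = 0 ∧ x₂ * y₁ = 0 := by
  obtain ⟨p, hp, ⟨α, β, h1⟩, γ, δ, h2⟩ := hA
  have e1 := hp.mul_one_sub_self
  have e2 := hp.one_sub_mul_self
  refine ⟨α * p, p * β, γ * (1 - p), (1 - p) * δ, ?_, ?_, ?_, ?_⟩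
  · rw [← h1, mul_assoc, ← mul_assoc p p, hp.eq, mul_assoc]
  · rw [mul_assoc, ← mul_assoc (1 - p) (1 - p), hp.one_sub.eq, ← mul_assoc, h2]
  · rw [mul_assoc, ← mul_assoc p, e1, zero_mul, mul_zero]
  · rw [mul_assoc, ← mul_assoc (1 - p), e2, zero_mul, mul_zero]

theorem Splits.of_ringEquiv {A B : Type u} [Ring A] [Ring B] (hA : Splits A) (φ : A ≃+* B) :
    Splits B := by
  obtain ⟨p, hp, ⟨α, β, h1⟩, γ, δ, h2⟩ := hA
  refine ⟨φ p, hp.map φ, ⟨φ α, φ β, ?_⟩, φ γ, φ δ, ?_⟩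
  · rw [← map_mul, ← map_mul, h1, map_one]
  · rw [← map_one φ, ← map_sub, ← map_mul, ← map_mul, h2]

/-- A unital ring embedded in `R` with image the corner of an idempotent is isomorphic to it. -/
theorem nonempty_ringEquiv_corner {A R : Type u} [Ring A] [NonUnitalRing R] (φ : A →ₙ+* R)
    (hinj : Function.Injective φ) (hφ : ∀ x, φ 1 * x = x → x * φ 1 = x → ∃ a, φ a = x) :
    ∃ (g : R) (hg : IsIdempotentElem g), Nonempty (A ≃+* hg.Corner) := by
  have hg : IsIdempotentElem (φ 1) := by
    show φ 1 * φ 1 = φ 1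
    rw [← map_mul, mul_one]
  refine ⟨φ 1, hg, ⟨RingEquiv.ofBijective
    (RingHom.mk' (⟨⟨fun a => ⟨φ a, φ a, ?_⟩, ?_⟩, ?_⟩ : A →* hg.Corner) ?_) ⟨?_, ?_⟩⟩⟩
  · show φ 1 * φ a * φ 1 = φ a
    rw [← map_mul, ← map_mul, one_mul, mul_one]
  · rfl
  · exact fun a b => Subtype.ext (map_mul φ a b)
  · exact fun a b => Subtype.ext (map_add φ a b)
  · exact fun a b h => hinj (congrArg Subtype.val h)
  · intro x
    obtain ⟨a, ha⟩ := hφ x.1 (corner_mul_left hg x) (corner_mul_right hg x)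
    exact ⟨a, Subtype.ext ha⟩

namespace UnitalMod

section Equivalence

variable {R S : Type u} [NonUnitalRing R] [NonUnitalRing S]

/-- Endomorphisms of a module over `S` factoring through the image of some left ideal `Re`
under a functor. -/
def FactorsThrough (hR : HasLocalUnits R) (F : UnitalMod R ⥤ UnitalMod S) {X : UnitalMod S}
    (e : R) (θ : X ⟶ X) : Prop :=
  ∃ (b : X ⟶ F.obj (leftIdeal hR e)) (a : F.obj (leftIdeal hR e) ⟶ X), θ = b ≫ a

/-- `Re` is contained in `Re'`, and right multiplication by `e` retracts `Re'` onto it. -/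
theorem FactorsThrough.of_mul_eq {hR : HasLocalUnits R} {F : UnitalMod R ⥤ UnitalMod S}
    {X : UnitalMod S} {e e' : R} {θ : X ⟶ X} (h : FactorsThrough hR F e θ)
    (he : IsIdempotentElem e) (hee' : e * e' = e) : FactorsThrough hR F e' θ := by
  obtain ⟨b, a, rfl⟩ := h
  let i : leftIdeal hR e ⟶ leftIdeal hR e' := ofElem hR e (M := leftIdeal hR e') ⟨e, hee'⟩
  let p : leftIdeal hR e' ⟶ leftIdeal hR e := ofElem hR e' (gen hR he)
  have hip : i ≫ p = 𝟙 _ := leftIdeal_hom_ext hR he (Subtype.ext (by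
    show e * e * e = e
    rw [he.eq, he.eq]))
  refine ⟨b ≫ F.map i, F.map p ≫ a, ?_⟩
  rw [Category.assoc, ← Category.assoc (F.map i), ← F.map_comp, hip, F.map_id, Category.id_comp]

theorem FactorsThrough.add {hR : HasLocalUnits R} {F : UnitalMod R ⥤ UnitalMod S} [F.Additive]
    {X : UnitalMod S} {e : R} {θ θ' : X ⟶ X} (h : FactorsThrough hR F e θ)
    (h' : FactorsThrough hR F e θ') (he : IsIdempotentElem e) (hs : Splits he.Corner) :
    FactorsThrough hR F e (θ + θ') := by
  obtain ⟨b, a, rfl⟩ := h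
  obtain ⟨b', a', rfl⟩ := h'
  obtain ⟨x₁, y₁, x₂, y₂, h11, h22, h12, h21⟩ := hs.exists_mul_eq
  have key : ∀ x y : he.Corner,
      F.map ((endEquiv hR he).symm x) ≫ F.map ((endEquiv hR he).symm y) =
        F.map ((endEquiv hR he).symm (x * y)) := fun x y => by
    rw [← F.map_comp]
    congr 1
    apply (endEquiv hR he).injective
    rw [endEquiv_comp]
    simp
  have h1 : F.map ((endEquiv hR he).symm 1) = 𝟙 _ := by
    rw [← endEquiv_id hR he, AddEquiv.symm_apply_apply, F.map_id]
  have h0 : F.map ((endEquiv hR he).symm 0) = 0 := by rw [map_zero, F.map_zero]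
  generalize hG : (fun x => F.map ((endEquiv hR he).symm x)) = G at *
  have hG' : ∀ x, F.map ((endEquiv hR he).symm x) = G x := fun x => congrFun hG x
  simp only [hG'] at key h1 h0
  have key' : ∀ x y {Z : UnitalMod S} (h : _ ⟶ Z), G x ≫ G y ≫ h = G (x * y) ≫ h :=
    fun x y Z h => by rw [← Category.assoc, key]
  -- The `x`'s and `y`'s exhibit `Re ⊕ Re` as a retract of `Re`; the cross terms vanish, leaving the
  -- sum of the two composites.
  refine ⟨b ≫ G x₁ + b' ≫ G x₂, G y₁ ≫ a + G y₂ ≫ a', ?_⟩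
  simp only [Preadditive.add_comp, Preadditive.comp_add, Category.assoc, key', h11, h12, h21, h22,
    h1, h0, Limits.zero_comp, Limits.comp_zero, add_zero, zero_add, Category.id_comp]

/-- Homomorphisms out of images of left ideals `Re` under an equivalence detect zero morphisms. -/
theorem eq_zero_of_forall_comp_eq_zero (hR : HasLocalUnits R) (E : UnitalMod R ≌ UnitalMod S)
    {X Y : UnitalMod S} (π : X ⟶ Y)
    (h : ∀ e : R, IsIdempotentElem e → ∀ φ : E.functor.obj (leftIdeal hR e) ⟶ X, φ ≫ π = 0) :
    π = 0 := by
  have := additive_of_isEquivalence E.functor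
  have := additive_of_isEquivalence E.inverse
  have hG : E.inverse.map π = 0 := by
    refine hom_ext fun m => ?_
    obtain ⟨e, he, hm⟩ := exists_idempotent_act_eq hR _ m
    have h1 : ofElem hR e m ≫ E.inverse.map π = 0 := by
      apply E.functor.map_injective
      rw [E.functor.map_comp, E.functor.map_zero]
      have h2 := h e he (E.functor.map (ofElem hR e m) ≫ E.counit.app X)
      have h3 := E.counit.naturality π
      simp only [Functor.comp_map, Functor.id_map] at h3
      rw [Category.assoc, ← h3] at h2
      have h4 : IsIso (E.counit.app Y) := inferInstance
      rw [← Category.assoc] at h2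
      rwa [← cancel_mono (E.counit.app Y), Limits.zero_comp]
    have h2 : (ofElem hR e m ≫ E.inverse.map π).toAddHom (gen hR he) = 0 := by rw [h1]; rfl
    rw [comp_apply, ofElem_apply] at h2
    rw [← hm]
    exact h2
  apply E.inverse.map_injective
  rw [hG, E.inverse.map_zero]

/-- The elements of a module which are reached from images of left ideals `Re` generate it. -/
theorem closure_range_eq_top (hR : HasLocalUnits R) (hS : HasLocalUnits S)
    (E : UnitalMod R ≌ UnitalMod S) (X : UnitalMod S) :
    AddSubgroup.closure {z : X.carrier | ∃ e : R, IsIdempotentElem e ∧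
      ∃ (φ : E.functor.obj (leftIdeal hR e) ⟶ X) (m : _), z = φ.toAddHom m} = ⊤ := by
  set N := AddSubgroup.closure {z : X.carrier | ∃ e : R, IsIdempotentElem e ∧
      ∃ (φ : E.functor.obj (leftIdeal hR e) ⟶ X) (m : _), z = φ.toAddHom m} with hN
  have hact : ∀ (s : S), ∀ z ∈ N, X.act s z ∈ N := by
    intro s z hz
    induction hz using AddSubgroup.closure_induction with
    | mem z hz =>
      obtain ⟨e, he, φ, m, rfl⟩ := hz
      exact AddSubgroup.subset_closure ⟨e, he, φ, _, (φ.map_act s m).symm⟩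
    | zero => rw [map_zero]; exact zero_mem _
    | add x y _ _ hx hy => rw [map_add]; exact add_mem hx hy
    | neg x _ hx => rw [map_neg]; exact neg_mem hx
  -- The projection modulo `N` kills every map from an image of some `Re`, so it is zero.
  have h0 : quotientMk hS X N hact = 0 := by
    refine eq_zero_of_forall_comp_eq_zero hR E _ fun e he φ => hom_ext fun m => ?_
    rw [comp_apply, zero_apply, quotientMk_apply_eq_zero]
    exact AddSubgroup.subset_closure ⟨e, he, φ, m, rfl⟩
  rw [eq_top_iff]
  intro z _
  rw [← quotientMk_apply_eq_zero hS X N hact, h0, zero_apply]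

/-- The module `Sf` is a retract of the image of some `Re`. -/
theorem exists_factorsThrough_id (hR : HasLocalUnits R) (hS : HasLocalUnits S)
    (hs : ∀ (e : R) (he : IsIdempotentElem e), Splits he.Corner)
    (E : UnitalMod R ≌ UnitalMod S) {f : S} (hf : IsIdempotentElem f) :
    ∃ e : R, IsIdempotentElem e ∧ FactorsThrough hR E.functor e (𝟙 (leftIdeal hS f)) := by
  classical
  have := additive_of_isEquivalence E.functor
  -- Generalizing from `f` to right multiplication by any `z ∈ Sf` allows induction over sums; `z =
  -- f` gives the identity.
  have key : ∀ z : (leftIdeal hS f).carrier, ∃ e : R, IsIdempotentElem e ∧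
      FactorsThrough hR E.functor e (ofElem hS f z) := by
    intro z
    have hz : z ∈ (⊤ : AddSubgroup (leftIdeal hS f).carrier) := trivial
    rw [← closure_range_eq_top hR hS E] at hz
    induction hz using AddSubgroup.closure_induction with
    | mem z hz =>
      obtain ⟨e, he, φ, m, rfl⟩ := hz
      exact ⟨e, he, ofElem hS f m, φ, hom_ext fun x => (φ.map_act x.1 m).symm⟩
    | zero => exact ⟨0, .zero, 0, 0, hom_ext fun x => by
        rw [Limits.comp_zero, ofElem_apply, map_zero, zero_apply]⟩
    | add x y _ _ hx hy =>
      obtain ⟨e, he, hx⟩ := hx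
      obtain ⟨e', he', hy⟩ := hy
      obtain ⟨g, hg, h⟩ := hR.exists_unit {e, e'}
      have hx := hx.of_mul_eq he (h e (by simp)).2
      have hy := hy.of_mul_eq he' (h e' (by simp)).2
      refine ⟨g, hg, ?_⟩
      have hxy := hx.add hy hg (hs g hg)
      convert hxy using 1
      exact hom_ext fun w => map_add ((leftIdeal hS f).act w.1) x y
    | neg x _ hx =>
      obtain ⟨e, he, b, a, h⟩ := hx
      refine ⟨e, he, -b, a, ?_⟩
      rw [Preadditive.neg_comp, ← h]
      exact hom_ext fun w => map_neg ((leftIdeal hS f).act w.1) x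
  obtain ⟨e, he, h⟩ := key (gen hS hf)
  refine ⟨e, he, ?_⟩
  convert h using 1
  exact leftIdeal_hom_ext hS hf (Subtype.ext hf.eq.symm)

/-- Every corner of `S` is isomorphic to a corner of `R`. -/
theorem exists_corner_ringEquiv (hR : HasLocalUnits R) (hS : HasLocalUnits S)
    (hs : ∀ (e : R) (he : IsIdempotentElem e), Splits he.Corner)
    (E : UnitalMod R ≌ UnitalMod S) {f : S} (hf : IsIdempotentElem f) :
    ∃ (g : R) (hg : IsIdempotentElem g), Nonempty (hf.Corner ≃+* hg.Corner) := by
  have := additive_of_isEquivalence E.functor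
  obtain ⟨e, he, b, a, hba⟩ := exists_factorsThrough_id hR hS hs E hf
  let ε := endEquiv hR he
  let η := endEquiv hS hf
  have hη : ∀ s t, η.symm (s * t) = η.symm s ≫ η.symm t := fun s t => by
    apply η.injective
    rw [endEquiv_comp]
    simp [η]
  have hη1 : η.symm 1 = 𝟙 _ := by rw [← endEquiv_id hS hf]; exact η.symm_apply_apply _
  -- Conjugation by the retraction: multiplicative because `b ≫ a` is the identity, with `1` sent to
  -- the idempotent of `a ≫ b`.
  let Φ : hf.Corner → he.Corner := fun s => ε (E.functor.preimage (a ≫ η.symm s ≫ b))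
  have hΦ : ∀ s, E.functor.map (ε.symm (Φ s)) = a ≫ η.symm s ≫ b := fun s => by simp [Φ]
  have hε : ∀ x y : he.Corner, E.functor.map (ε.symm x) = E.functor.map (ε.symm y) → x = y :=
    fun x y h => ε.symm.injective (E.functor.map_injective h)
  have hεmul : ∀ x y, E.functor.map (ε.symm (x * y)) =
      E.functor.map (ε.symm x) ≫ E.functor.map (ε.symm y) := fun x y => by
    rw [← E.functor.map_comp]
    congr 1
    apply ε.injective
    rw [endEquiv_comp]
    simp [ε]
  have hba' : ∀ {Z : UnitalMod S} (h : leftIdeal hS f ⟶ Z), b ≫ a ≫ h = h := fun h => by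
    rw [← Category.assoc, ← hba, Category.id_comp]
  let φ : hf.Corner →ₙ+* R :=
    { toFun := fun s => (Φ s).1
      map_mul' := fun s t => by
        rw [← corner_coe_mul]
        congr 1
        apply hε
        rw [hεmul, hΦ, hΦ, hΦ, hη]
        simp only [Category.assoc, hba']
      map_zero' := by
        rw [← corner_coe_zero he]
        congr 1
        apply hε
        rw [hΦ]
        simp
      map_add' := fun s t => by
        rw [← corner_coe_add]
        congr 1
        apply hε
        rw [map_add, E.functor.map_add, hΦ, hΦ, hΦ]
        simp }
  refine nonempty_ringEquiv_corner φ (fun s t h => ?_) fun x h1 h2 => ?_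
  · have h : Φ s = Φ t := Subtype.ext h
    have h' : a ≫ η.symm s ≫ b = a ≫ η.symm t ≫ b := by rw [← hΦ, ← hΦ, h]
    apply η.symm.injective
    calc η.symm s = b ≫ (a ≫ η.symm s ≫ b) ≫ a := by
          simp only [Category.assoc, hba', ← hba, Category.comp_id]
      _ = η.symm t := by
          rw [h']; simp only [Category.assoc, hba', ← hba, Category.comp_id]
  · have h1 : (Φ 1).1 * x = x := h1
    have h2 : x * (Φ 1).1 = x := h2
    have hx : e * x = x ∧ x * e = x := by
      constructor
      · rw [← h1, ← mul_assoc, corner_mul_left]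
      · rw [← h2, mul_assoc, corner_mul_right]
    have hx' : (compress he x).1 = x := coe_compress_of_mul he hx
    have h3 : Φ 1 * compress he x * Φ 1 = compress he x := Subtype.ext (by
      rw [corner_coe_mul, corner_coe_mul, hx', h1, h2])
    -- The inverse compresses back along `b` and `a`; `x` is recovered because it is fixed by `Φ 1`
    -- on both sides.
    refine ⟨η (b ≫ E.functor.map (ε.symm (compress he x)) ≫ a), ?_⟩
    show (Φ _).1 = x
    conv_rhs => rw [← hx', ← h3]
    congr 1
    apply hε
    rw [hΦ, hεmul, hεmul, hΦ, hη1, AddEquiv.symm_apply_apply]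
    simp only [Category.assoc, Category.id_comp]

end Equivalence

end UnitalMod

theorem IsPurelyInfinite.of_moritaEquivalent {R S : Type u} [NonUnitalRing R] [NonUnitalRing S]
    (hR : HasLocalUnits R) (hS : HasLocalUnits S) (E : UnitalMod R ≌ UnitalMod S)
    (hpi : IsPurelyInfinite R) (hex : IsExchange R) : IsPurelyInfinite S ∧ IsExchange S := by
  have hs : ∀ (e : R) (he : IsIdempotentElem e), Splits he.Corner :=
    fun e he => hpi.corner_splits hex he
  have key : ∀ (f : S) (hf : IsIdempotentElem f),
      IsExchange hf.Corner ∧ HasComparison hf.Corner ∧ Splits hf.Corner := by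
    intro f hf
    obtain ⟨g, hg, ⟨φ⟩⟩ := UnitalMod.exists_corner_ringEquiv hR hS hs E hf
    exact ⟨(hex.corner hg).of_surjective (φ.symm : hg.Corner →ₙ+* hf.Corner) φ.symm.surjective,
      (HasComparison.corner hg hpi.2).of_surjective (φ.symm : hg.Corner →ₙ+* hf.Corner)
        φ.symm.surjective, (hs g hg).of_ringEquiv φ.symm⟩
  exact ⟨⟨hS.not_isDivRing fun f hf => (key f hf).2.2,
    hS.hasComparison fun f hf => (key f hf).2.1⟩, hS.isExchange fun f hf => (key f hf).1⟩

end NonUnitalMorita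

theorem mainTheorem4 {R S : Type u} [NonUnitalRing R] [NonUnitalRing S]
    (hR : NonUnitalMorita.HasLocalUnits R) (hS : NonUnitalMorita.HasLocalUnits S)
    (hRS : NonUnitalMorita.MoritaEquivalent R S) :
    (NonUnitalMorita.IsPurelyInfinite R ∧ NonUnitalMorita.IsExchange R) ↔
      (NonUnitalMorita.IsPurelyInfinite S ∧ NonUnitalMorita.IsExchange S) := by
  obtain ⟨E⟩ := hRS
  exact ⟨fun h => h.1.of_moritaEquivalent hR hS E h.2,
    fun h => h.1.of_moritaEquivalent hS hR E.symm h.2⟩
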